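/- For an entire function $g$ and $r \ge 0$ write $M(r,g)=\max_{|z|=r}|g(z)|$ and $m(r,g)=\min_{|z|=r}|g(z)|$. Let $f^n$ denote the $n$-th iterate of $f$, and let $M^n(r,f)$ denote the $n$-th iterate of the function $r\mapsto M(r,f)$, evaluated at $r$. For $0<r_1<r_2$ let $A(r_1,r_2)=\{z\in\mathbb{C}: r_1<|z|<r_2\}$, and for $\zeta\in\mathbb{C}$ and real $\rho$ let $B(\zeta,\rho)=\{z\in\mathbb{C}:|z-\zeta|<\rho\}$ (empty if $\rho\le 0$). Suppose that $f$ is a transcendental entire function (that is, $f$ is entire and not a polynomial), and that $1<\lambda<\lambda'<\lambda''$. Then there exist $R'>0$ and a function $\epsilon:\mathbb{R}\to\mathbb{R}$, depending only on $f,\lambda,\lambda',\lambda''$, with $\epsilon(r)\to 0$ as $r\to\infty$, such that the following holds. If $r\ge R'$, $n\ge 1$ is an integer, $\eta\ge 0$, and there exists $s\in(\lambda r,\lambda' r)$ such that $m(s,f^n)\le\eta$, then there exists $w\in B(0,M^n(r,f))$ such that $$f^n(A(r,\lambda'' r))\supset B(0,M^n(r,f))\setminus B\bigl(w,\epsilon(r)\max\{|w|,\eta\}\bigr).$$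 -/

import Mathlib

/-- A transcendental entire function: holomorphic on the whole plane and not a polynomial. -/
def IsTranscendentalEntire (f : ℂ → ℂ) : Prop :=
  Differentiable ℂ f ∧ ¬ ∃ p : Polynomial ℂ, ∀ z, f z = p.eval z

/-- The maximum modulus `M(r, f) = max_{|z| = r} |f z|` (the supremum is attained when
`f` is continuous and `0 ≤ r`). Its `n`-fold iterate in `r` is `(maxModulus f)^[n]`. -/
noncomputable def maxModulus (f : ℂ → ℂ) (r : ℝ) : ℝ :=
  sSup ((fun z => ‖f z‖) '' Metric.sphere (0 : ℂ) r)

/-- The minimum modulus `m(r, f) = min_{|z| = r} |f z|` (the infimum is attained when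
`f` is continuous and `0 ≤ r`). -/
noncomputable def minModulus (f : ℂ → ℂ) (r : ℝ) : ℝ :=
  sInf ((fun z => ‖f z‖) '' Metric.sphere (0 : ℂ) r)

/-- The open annulus `A(r₁, r₂)` centred at the origin. -/
def openAnnulus (r₁ r₂ : ℝ) : Set ℂ :=
  {z | r₁ < ‖z‖ ∧ ‖z‖ < r₂}

/-!
By Schottky's theorem, a function `g` which omits `w₁` and `w₂` in an annulus about the circle
`|z| = s`, and for which `|g z₀ - w₁|` is at most a multiple of `|w₂ - w₁|` at one point of this
circle, is bounded on the whole circle by `|w₁| + Ψ |w₂ - w₁|`. For `g = f^n` such a point is one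
where `|g|` attains `m(s, f^n) ≤ η`, provided `w₂` lies at distance at least `e max(|w₁|, η)` from
`w₁`. If moreover `w₁` and `w₂` lie in the disc of radius `M^n(r, f)`, then
`M(λ r, f^n) ≤ (1 + 2 Ψ) M^n(r, f)`, so it suffices that `M(λ r, f^n) / M^n(r, f)` tends to
infinity uniformly in `n`.

For `n = 1` this holds because `f` is transcendental. It passes to the iterates because
`f (B(0, λ r))` contains a circle of radius at least `λ M(r, f)`: otherwise `f` would omit a value
on each of the circles of radii `λ M(r, f)` and `2 λ M(r, f)`, and Schottky's theorem would bound
`M(a r, f) / M(r, f)` for some `a > 1`. Finally `e` is made to depend on `r` by a diagonal choice.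
-/

open Asymptotics Bornology Filter Metric Set Topology
open scoped Real

/-! ### Bloch's theorem -/

theorem closedBall_subset_image_of_norm_deriv_sub_le {𝕜 : Type*} [RCLike 𝕜] {F : 𝕜 → 𝕜}
    {a : 𝕜} {t : ℝ} (ht : 0 ≤ t)
    (hF : ∀ z ∈ closedBall a t, DifferentiableAt 𝕜 F z) (ha : deriv F a ≠ 0)
    (hb : ∀ z ∈ closedBall a t, ‖deriv F z - deriv F a‖ ≤ ‖deriv F a‖ / 2) :
    closedBall (F a) (‖deriv F a‖ / 2 * t) ⊆ F '' closedBall a t := by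
  let D : 𝕜 →L[𝕜] 𝕜 := ContinuousLinearMap.toSpanSingletonCLE (deriv F a)
  have hlin : ApproximatesLinearOn F D (closedBall a t) (‖deriv F a‖₊ / 2) := by
    intro x hx y hy
    refine (convex_closedBall a t).norm_image_sub_le_of_norm_hasFDerivWithin_le'
      (fun z hz => (hF z hz).hasDerivAt.hasFDerivAt.hasFDerivWithinAt) (fun z hz => ?_) hy hx
    calc _ = ‖ContinuousLinearMap.toSpanSingleton 𝕜 (deriv F z - deriv F a)‖ :=
          congrArg norm (map_sub ContinuousLinearMap.toSpanSingletonCLE _ _).symm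
      _ ≤ _ := (ContinuousLinearMap.norm_toSpanSingleton _).trans_le (hb z hz)
  let Dinv : D.NonlinearRightInverse :=
    { toFun := fun w => w / deriv F a
      nnnorm := ‖deriv F a‖₊⁻¹
      bound' := fun w => by simp [div_eq_inv_mul]
      right_inv' := fun w => by simp [D, ha] }
  have hconst : ‖deriv F a‖ / 2 = (Dinv.nnnorm : ℝ)⁻¹ - (‖deriv F a‖₊ / 2 : NNReal) := by
    simp only [Dinv, NNReal.coe_inv, NNReal.coe_div, NNReal.coe_ofNat, coe_nnnorm, inv_inv]
    ring
  rw [hconst]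
  exact hlin.surjOn_closedBall_of_nonlinearRightInverse Dinv ht subset_rfl

/-- The Schwarz lemma makes `F'` almost constant on the disc of radius `t / 6`. -/
theorem closedBall_subset_image_of_norm_deriv_le {F : ℂ → ℂ} {a : ℂ} {t : ℝ} (ht : 0 < t)
    (hF : DifferentiableOn ℂ F (ball a t)) (ha : deriv F a ≠ 0)
    (hb : ∀ z ∈ ball a t, ‖deriv F z‖ ≤ 2 * ‖deriv F a‖) :
    closedBall (F a) (‖deriv F a‖ * t / 12) ⊆ F '' ball a t := by
  have hsub : closedBall a (t / 6) ⊆ ball a t := closedBall_subset_ball (by linarith)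
  have hmaps : MapsTo (deriv F) (ball a t) (closedBall (deriv F a) (3 * ‖deriv F a‖)) := by
    intro z hz
    rw [mem_closedBall, dist_eq_norm]
    linarith [norm_sub_le (deriv F z) (deriv F a), hb z hz]
  have hderiv : ∀ z ∈ closedBall a (t / 6), ‖deriv F z - deriv F a‖ ≤ ‖deriv F a‖ / 2 := by
    intro z hz
    calc ‖deriv F z - deriv F a‖
        ≤ 3 * ‖deriv F a‖ / t * dist z a := by
          rw [← dist_eq_norm]
          exact Complex.dist_le_div_mul_dist_of_mapsTo_ball (hF.deriv isOpen_ball) hmaps (hsub hz)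
      _ ≤ 3 * ‖deriv F a‖ / t * (t / 6) := by gcongr; exact hz
      _ = ‖deriv F a‖ / 2 := by field_simp; norm_num
  convert! (closedBall_subset_image_of_norm_deriv_sub_le (by positivity)
    (fun z hz => hF.differentiableAt (isOpen_ball.mem_nhds (hsub hz))) ha hderiv).trans
    (image_mono hsub) using 2
  ring

theorem exists_ball_forall_norm_deriv_le {G : ℂ → ℂ} {c : ℂ} {R : ℝ} (hR : 0 < R)
    (hG : DifferentiableOn ℂ G (ball c R)) (hc : deriv G c ≠ 0) :
    ∃ a t, 0 < t ∧ ball a t ⊆ ball c R ∧ ‖deriv G c‖ * R ≤ 4 * (‖deriv G a‖ * t) ∧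
      ∀ z ∈ ball a t, ‖deriv G z‖ ≤ 2 * ‖deriv G a‖ := by
  have hsub : closedBall c (R / 2) ⊆ ball c R := closedBall_subset_ball (by linarith)
  -- `a` maximises `‖G' z‖` weighted by the distance of `z` to the circle of radius `R / 2`.
  obtain ⟨a, -, hmax⟩ := (isCompact_closedBall c (R / 2)).exists_isMaxOn
    ⟨c, mem_closedBall_self (by linarith)⟩
    (f := fun z => ‖deriv G z‖ * (R / 2 - dist z c))
    (((hG.deriv isOpen_ball).continuousOn.mono hsub).norm.mul (by fun_prop))
  obtain ⟨t, ht⟩ : ∃ t, R / 2 - dist a c = 2 * t := ⟨(R / 2 - dist a c) / 2, by ring⟩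
  have hca : ‖deriv G c‖ * (R / 2) ≤ ‖deriv G a‖ * (2 * t) := by
    simpa [ht] using hmax (mem_closedBall_self (show 0 ≤ R / 2 by linarith))
  have ht0 : 0 < t := by
    have hpos : 0 < ‖deriv G a‖ * (2 * t) :=
      lt_of_lt_of_le (mul_pos (norm_pos_iff.2 hc) (by linarith)) hca
    linarith [pos_of_mul_pos_right hpos (norm_nonneg _)]
  have hdist : ∀ z ∈ ball a t, t ≤ R / 2 - dist z c := fun z hz => by
    linarith [dist_triangle z a c, mem_ball.1 hz]
  refine ⟨a, t, ht0, fun z hz => mem_ball.2 (by linarith [hdist z hz]), by linarith,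
    fun z hz => le_of_mul_le_mul_right ?_ ht0⟩
  calc ‖deriv G z‖ * t ≤ ‖deriv G z‖ * (R / 2 - dist z c) := by gcongr; exact hdist z hz
    _ ≤ ‖deriv G a‖ * (R / 2 - dist a c) :=
      hmax (mem_closedBall.2 (by linarith [hdist z hz]))
    _ = 2 * ‖deriv G a‖ * t := by rw [ht]; ring

/-- **Bloch's theorem**, with the constant `1 / 48`. -/
theorem exists_ball_subset_image {G : ℂ → ℂ} {c : ℂ} {R : ℝ}
    (hG : DifferentiableOn ℂ G (ball c R)) :
    ∃ p, ball p (‖deriv G c‖ * R / 48) ⊆ G '' ball c R := by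
  rcases le_or_gt R 0 with hR | hR
  · exact ⟨0, by
      rw [ball_eq_empty.2 (by nlinarith [norm_nonneg (deriv G c)])]; exact empty_subset _⟩
  rcases eq_or_ne (deriv G c) 0 with hc | hc
  · exact ⟨0, by simp [hc]⟩
  obtain ⟨a, t, ht, hsub, hca, hle⟩ := exists_ball_forall_norm_deriv_le hR hG hc
  have ha : deriv G a ≠ 0 := fun h => by
    have : 0 < ‖deriv G c‖ * R := mul_pos (norm_pos_iff.2 hc) hR
    simp only [h, norm_zero] at hca
    linarith
  have hcov := closedBall_subset_image_of_norm_deriv_le ht (hG.mono hsub) ha hle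
  exact ⟨G a, (ball_subset_closedBall.trans (closedBall_subset_closedBall (by linarith))).trans
    (hcov.trans (image_mono hsub))⟩

theorem norm_sub_le_of_forall_not_ball_subset_image {G : ℂ → ℂ} {c : ℂ} {R ρ θ : ℝ}
    (hθ₀ : 0 < θ) (hθ : θ < 1) (hG : DifferentiableOn ℂ G (ball c R))
    (hρ : ∀ p, ¬ ball p ρ ⊆ G '' ball c R) {z : ℂ} (hz : z ∈ ball c (θ * R)) :
    ‖G z - G c‖ ≤ 48 * ρ * θ / (1 - θ) := by
  have hθR : 0 < θ * R := pos_of_mem_ball hz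
  have hR : 0 < R := pos_of_mul_pos_right hθR hθ₀.le
  have hθ' : 0 < 1 - θ := sub_pos.2 hθ
  have hderiv : ∀ x ∈ ball c (θ * R), ‖deriv G x‖ ≤ 48 * ρ / ((1 - θ) * R) := by
    intro x hx
    have hsub : ball x ((1 - θ) * R) ⊆ ball c R :=
      ball_subset_ball' (by linarith [mem_ball.1 hx])
    obtain ⟨p, hp⟩ := exists_ball_subset_image (hG.mono hsub)
    have hlt : ‖deriv G x‖ * ((1 - θ) * R) / 48 < ρ := by
      by_contra! h
      exact hρ p ((ball_subset_ball h).trans (hp.trans (image_mono hsub)))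
    rw [le_div_iff₀ (by positivity)]
    linarith
  have hsub : ball c (θ * R) ⊆ ball c R := ball_subset_ball (by nlinarith)
  calc ‖G z - G c‖ ≤ 48 * ρ / ((1 - θ) * R) * ‖z - c‖ :=
        (convex_ball c (θ * R)).norm_image_sub_le_of_norm_deriv_le
          (fun x hx => hG.differentiableAt (isOpen_ball.mem_nhds (hsub hx))) hderiv
          (mem_ball_self hθR) hz
    _ ≤ 48 * ρ / ((1 - θ) * R) * (θ * R) := by
        gcongr
        · exact (norm_nonneg _).trans (hderiv z hz)
        · exact (mem_ball_iff_norm.1 hz).le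
    _ = 48 * ρ * θ / (1 - θ) := by field_simp

/-! ### Schottky's theorem -/

theorem exists_exp_eq_of_ne_zero {h : ℂ → ℂ} {c : ℂ} {R : ℝ}
    (hd : DifferentiableOn ℂ h (ball c R)) (h0 : ∀ z ∈ ball c R, h z ≠ 0) :
    ∃ l : ℂ → ℂ, DifferentiableOn ℂ l (ball c R) ∧ ∀ z ∈ ball c R, Complex.exp (l z) = h z := by
  have hlogDeriv : DifferentiableOn ℂ (fun z => deriv h z / h z) (ball c R) :=
    (hd.deriv isOpen_ball).div hd h0
  obtain ⟨l, hlc, hl⟩ := hlogDeriv.isExactOn_ball.with_val_at c (Complex.log (h c))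
  refine ⟨l, fun z hz => (hl z hz).differentiableAt.differentiableWithinAt, fun z hz => ?_⟩
  have hc : c ∈ ball c R := mem_ball_self (pos_of_mem_ball hz)
  have hderiv : ∀ x ∈ ball c R, HasDerivAt (fun z => h z * Complex.exp (-l z)) 0 x := by
    intro x hx
    have hdx := (hd.differentiableAt (isOpen_ball.mem_nhds hx)).hasDerivAt
    refine (hdx.mul (hl x hx).neg.cexp).congr_deriv ?_
    have := h0 x hx
    field_simp
    ring
  have hconst : h z * Complex.exp (-l z) = h c * Complex.exp (-l c) :=
    isOpen_ball.is_const_of_deriv_eq_zero (convex_ball c R).isPreconnected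
      (fun x hx => (hderiv x hx).differentiableAt.differentiableWithinAt)
      (fun x hx => (hderiv x hx).deriv) hz hc
  rw [hlc, Complex.exp_neg (Complex.log _), Complex.exp_log (h0 c hc), mul_inv_cancel₀ (h0 c hc),
    Complex.exp_neg] at hconst
  exact (eq_of_mul_inv_eq_one hconst).symm

theorem exists_cos_eq_of_ne {h : ℂ → ℂ} {c : ℂ} {R : ℝ} (hd : DifferentiableOn ℂ h (ball c R))
    (h₁ : ∀ z ∈ ball c R, h z ≠ 1) (h₂ : ∀ z ∈ ball c R, h z ≠ -1) :
    ∃ F : ℂ → ℂ, DifferentiableOn ℂ F (ball c R) ∧ ∀ z ∈ ball c R, Complex.cos (F z) = h z := by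
  obtain ⟨l, hl, hl_exp⟩ := exists_exp_eq_of_ne_zero (h := fun z => h z ^ 2 - 1)
    ((hd.pow 2).sub_const 1) fun z hz => by simp [sub_eq_zero, sq_eq_one_iff, h₁ z hz, h₂ z hz]
  have hsqrt : ∀ z ∈ ball c R, Complex.exp (l z / 2) ^ 2 = h z ^ 2 - 1 := fun z hz => by
    rw [← hl_exp z hz, ← Complex.exp_nat_mul, Nat.cast_ofNat, mul_div_cancel₀ _ two_ne_zero]
  obtain ⟨k, hk, hk_exp⟩ := exists_exp_eq_of_ne_zero (h := fun z => h z + Complex.exp (l z / 2))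
    (hd.add (hl.div_const 2).cexp) fun z hz hzero => by
      have hone : (h z + Complex.exp (l z / 2)) * (h z - Complex.exp (l z / 2)) = 1 := by
        linear_combination -(hsqrt z hz)
      simp [hzero] at hone
  refine ⟨fun z => -Complex.I * k z, hk.const_mul _, fun z hz => ?_⟩
  have hkI : -Complex.I * k z * Complex.I = k z := by linear_combination -k z * Complex.I_mul_I
  rw [Complex.cos_eq_iff_quadratic, hkI, hk_exp z hz]
  linear_combination hsqrt z hz

theorem abs_im_le_norm_cos (z : ℂ) : |z.im| ≤ ‖Complex.cos z‖ := by
  have hexp : |Real.exp (-z.im) - Real.exp z.im| ≤ 2 * ‖Complex.cos z‖ := by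
    have h := abs_norm_sub_norm_le (Complex.exp (z * Complex.I)) (-Complex.exp (-z * Complex.I))
    rw [sub_neg_eq_add, ← Complex.two_cos, norm_mul, Complex.norm_two, norm_neg] at h
    simpa [Complex.norm_exp] using h
  have hsinh : |Real.exp (-z.im) - Real.exp z.im| = 2 * Real.sinh |z.im| := by
    rw [← Real.abs_sinh, Real.sinh_eq, abs_div, abs_two, abs_sub_comm]
    ring
  linarith [Real.self_le_sinh_iff.2 (abs_nonneg z.im)]

theorem norm_cos_le_exp_norm (z : ℂ) : ‖Complex.cos z‖ ≤ Real.exp ‖z‖ := by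
  have hpos : ‖Complex.exp (z * Complex.I)‖ ≤ Real.exp ‖z‖ := by
    simpa using Complex.norm_exp_le_exp_norm (z * Complex.I)
  have hneg : ‖Complex.exp (-z * Complex.I)‖ ≤ Real.exp ‖z‖ := by
    simpa using Complex.norm_exp_le_exp_norm (-z * Complex.I)
  rw [Complex.cos, norm_div, Complex.norm_two, div_le_iff₀ two_pos]
  linarith [norm_add_le (Complex.exp (z * Complex.I)) (Complex.exp (-z * Complex.I))]

theorem exists_int_abs_sub_mul_two_le (x : ℝ) : ∃ m : ℤ, |x - m * 2| ≤ 1 := by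
  refine ⟨round (x / 2), ?_⟩
  have h := abs_le.1 (abs_sub_round (x / 2))
  exact abs_le.2 ⟨by linarith [h.1], by linarith [h.2]⟩

theorem exists_cos_pi_mul_eq_of_ne {h : ℂ → ℂ} {c : ℂ} {R : ℝ}
    (hd : DifferentiableOn ℂ h (ball c R)) (h₁ : ∀ z ∈ ball c R, h z ≠ 1)
    (h₂ : ∀ z ∈ ball c R, h z ≠ -1) (hc : c ∈ ball c R) :
    ∃ F : ℂ → ℂ, DifferentiableOn ℂ F (ball c R) ∧
      (∀ z ∈ ball c R, Complex.cos (π * F z) = h z) ∧ ‖F c‖ ≤ 1 + ‖h c‖ := by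
  obtain ⟨k, hk, hk_cos⟩ := exists_cos_eq_of_ne hd h₁ h₂
  obtain ⟨m, hm⟩ := exists_int_abs_sub_mul_two_le (k c / π).re
  have hcos : ∀ z ∈ ball c R, Complex.cos (π * (k z / π - m * 2)) = h z := fun z hz => by
    rw [← hk_cos z hz, ← Complex.cos_sub_int_mul_two_pi (k z) m]
    congr 1
    field_simp
  refine ⟨fun z => k z / π - m * 2, (hk.div_const _).sub_const _, hcos, ?_⟩
  have hre : |(k c / π - m * 2).re| ≤ 1 := by simpa using hm
  have him : |(k c / π - m * 2).im| ≤ ‖h c‖ := by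
    have h := abs_im_le_norm_cos (π * (k c / π - m * 2))
    rw [hcos c hc, Complex.im_ofReal_mul, abs_mul, abs_of_pos Real.pi_pos] at h
    nlinarith [abs_nonneg (k c / π - m * 2).im, Real.pi_gt_three]
  linarith [Complex.norm_le_abs_re_add_abs_im (k c / π - m * 2)]

theorem cosh_pi_mul_add_one_le {y : ℝ} (hy : 0 ≤ y) :
    Real.cosh (π * y) + 1 ≤ Real.cosh (π * (y + 1)) := by
  have hpi : 2 ≤ Real.cosh π := by
    linarith [Real.self_le_sinh_iff.2 Real.pi_pos.le, Real.sinh_lt_cosh π, Real.pi_gt_three]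
  have hsinh : 0 ≤ Real.sinh (π * y) * Real.sinh π :=
    mul_nonneg (Real.sinh_nonneg_iff.2 (by positivity)) (Real.sinh_nonneg_iff.2 Real.pi_pos.le)
  rw [mul_add, mul_one, Real.cosh_add]
  nlinarith [Real.one_le_cosh (π * y)]

theorem exists_cosh_pi_mul_eq_int (x : ℝ) :
    ∃ y : ℝ, |y - x| ≤ 1 ∧ ∃ n : ℤ, Real.cosh (π * y) = n := by
  wlog hx : 0 ≤ x generalizing x
  · obtain ⟨y, hy, n, hn⟩ := this (-x) (by linarith)
    refine ⟨-y, ?_, n, by rw [mul_neg, Real.cosh_neg, hn]⟩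
    rwa [show -y - x = -(y - -x) by ring, abs_neg]
  have hceil : (⌈Real.cosh (π * x)⌉ : ℝ) ∈
      Icc (Real.cosh (π * x)) (Real.cosh (π * (x + 1))) :=
    ⟨Int.le_ceil _, (Int.ceil_lt_add_one _).le.trans (cosh_pi_mul_add_one_le hx)⟩
  obtain ⟨y, hy, hy_cosh⟩ := intermediate_value_Icc (show x ≤ x + 1 by linarith)
    (f := fun y => Real.cosh (π * y)) (by fun_prop) hceil
  exact ⟨y, abs_le.2 ⟨by linarith [hy.1], by linarith [hy.2]⟩, _, hy_cosh⟩

theorem exists_mem_ball_cos_pi_mul_eq_int (p : ℂ) :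
    ∃ q ∈ ball p 3, ∃ n : ℤ, Complex.cos (π * q) = n := by
  obtain ⟨y, hy, n, hn⟩ := exists_cosh_pi_mul_eq_int p.im
  obtain ⟨m, hm⟩ := exists_int_abs_sub_mul_two_le p.re
  refine ⟨y * Complex.I + m * 2, ?_, n, ?_⟩
  · rw [abs_sub_comm] at hm
    have h := Complex.norm_le_abs_re_add_abs_im (y * Complex.I + m * 2 - p)
    simp only [Complex.sub_re, Complex.add_re, Complex.mul_re, Complex.ofReal_re, Complex.I_re,
      mul_zero, Complex.ofReal_im, Complex.I_im, mul_one, sub_self, Complex.intCast_re,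
      Complex.re_ofNat, Complex.intCast_im, Complex.im_ofNat, sub_zero, zero_add, Complex.sub_im,
      Complex.add_im, Complex.mul_im, add_zero, zero_mul] at h
    rw [mem_ball_iff_norm]
    linarith
  · have harg : (π : ℂ) * (y * Complex.I + m * 2) =
        (π * y : ℝ) * Complex.I + m * (2 * π) := by
      push_cast
      ring
    rw [harg, Complex.cos_add_int_mul_two_pi, Complex.cos_mul_I, ← Complex.ofReal_cosh, hn,
      Complex.ofReal_intCast]

theorem exists_cos_pi_mul_cos_pi_mul_eq {h : ℂ → ℂ} {c : ℂ} {R : ℝ}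
    (hd : DifferentiableOn ℂ h (ball c R)) (h₁ : ∀ z ∈ ball c R, h z ≠ 1)
    (h₂ : ∀ z ∈ ball c R, h z ≠ -1) (hc : c ∈ ball c R) :
    ∃ G : ℂ → ℂ, DifferentiableOn ℂ G (ball c R) ∧
      (∀ z ∈ ball c R, Complex.cos (π * Complex.cos (π * G z)) = h z) ∧
      ‖G c‖ ≤ 2 + ‖h c‖ ∧ ∀ p, ¬ ball p 3 ⊆ G '' ball c R := by
  obtain ⟨F, hF, hF_cos, hF_norm⟩ := exists_cos_pi_mul_eq_of_ne hd h₁ h₂ hc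
  have hF_int : ∀ z ∈ ball c R, ∀ n : ℤ, F z ≠ n := by
    intro z hz n hn
    have hsin : Complex.sin (π * F z) = 0 := by rw [hn, mul_comm, Complex.sin_int_mul_pi]
    rcases Complex.sin_eq_zero_iff_cos_eq.1 hsin with hcos | hcos <;> rw [hF_cos z hz] at hcos
    · exact h₁ z hz hcos
    · exact h₂ z hz hcos
  obtain ⟨G, hG, hG_cos, hG_norm⟩ := exists_cos_pi_mul_eq_of_ne hF
    (fun z hz => by simpa using hF_int z hz 1) (fun z hz => by simpa using hF_int z hz (-1)) hc
  refine ⟨G, hG, fun z hz => by rw [hG_cos z hz, hF_cos z hz], by linarith, fun p hp => ?_⟩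
  obtain ⟨q, hq, n, hn⟩ := exists_mem_ball_cos_pi_mul_eq_int p
  obtain ⟨z, hz, rfl⟩ := hp hq
  exact hF_int z hz n ((hG_cos z hz).symm.trans hn)

theorem norm_cos_pi_mul_le {w : ℂ} {b : ℝ} (hw : ‖w‖ ≤ b) :
    ‖Complex.cos (π * w)‖ ≤ Real.exp (π * b) := by
  refine (norm_cos_le_exp_norm _).trans (Real.exp_le_exp.2 ?_)
  rw [norm_mul, Complex.norm_real, Real.norm_of_nonneg Real.pi_pos.le]
  gcongr

theorem norm_le_of_ne_one_of_ne_neg_one {h : ℂ → ℂ} {c : ℂ} {R θ : ℝ} (hθ₀ : 0 < θ) (hθ : θ < 1)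
    (hd : DifferentiableOn ℂ h (ball c R)) (h₁ : ∀ z ∈ ball c R, h z ≠ 1)
    (h₂ : ∀ z ∈ ball c R, h z ≠ -1) {z : ℂ} (hz : z ∈ ball c (θ * R)) :
    ‖h z‖ ≤ Real.exp (π * Real.exp (π * (2 + ‖h c‖ + 144 * θ / (1 - θ)))) := by
  have hR : 0 < R := pos_of_mul_pos_right (pos_of_mem_ball hz) hθ₀.le
  obtain ⟨G, hG, hG_cos, hG_norm, hG_image⟩ :=
    exists_cos_pi_mul_cos_pi_mul_eq hd h₁ h₂ (mem_ball_self hR)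
  rw [← hG_cos z (ball_subset_ball (by nlinarith) hz)]
  refine norm_cos_pi_mul_le (norm_cos_pi_mul_le ?_)
  have hGz := norm_sub_le_of_forall_not_ball_subset_image hθ₀ hθ hG hG_image hz
  rw [show (48 * 3 : ℝ) = 144 by norm_num] at hGz
  linarith [norm_sub_norm_le (G z) (G c)]

/-- The bound in Schottky's theorem: `θ` is the ratio of the radii of the two discs, and `B` bounds
the function at their common centre. The two exponentials come from writing a function that omits
`1` and `-1` as `cos (π cos (π G))`. -/
noncomputable def schottkyBound (θ B : ℝ) : ℝ :=
  (1 + Real.exp (π * Real.exp (π * (3 + 2 * B + 144 * θ / (1 - θ))))) / 2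

theorem schottkyBound_nonneg (θ B : ℝ) : 0 ≤ schottkyBound θ B := by
  rw [schottkyBound]
  positivity

theorem schottkyBound_iterate_nonneg (θ : ℝ) {B : ℝ} (hB : 0 ≤ B) (N : ℕ) :
    0 ≤ (schottkyBound θ)^[N] B :=
  MapsTo.iterate (s := Ici 0) (fun B _ => schottkyBound_nonneg θ B) N hB

/-- **Schottky's theorem**, for a function omitting `w₁` and `w₂` instead of `0` and `1`. -/
theorem norm_sub_le_schottkyBound_mul {g : ℂ → ℂ} {w₁ w₂ c : ℂ} {R θ B : ℝ} (hθ₀ : 0 < θ)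
    (hθ : θ < 1) (hg : DifferentiableOn ℂ g (ball c R)) (hw : w₁ ≠ w₂)
    (h₁ : w₁ ∉ g '' ball c R) (h₂ : w₂ ∉ g '' ball c R) (hB : ‖g c - w₁‖ ≤ B * ‖w₂ - w₁‖)
    {z : ℂ} (hz : z ∈ ball c (θ * R)) :
    ‖g z - w₁‖ ≤ schottkyBound θ B * ‖w₂ - w₁‖ := by
  have hw' : w₂ - w₁ ≠ 0 := sub_ne_zero.2 hw.symm
  let h : ℂ → ℂ := fun z => 2 * ((g z - w₁) / (w₂ - w₁)) - 1
  have hgh : ∀ z, ‖g z - w₁‖ / ‖w₂ - w₁‖ = ‖h z + 1‖ / 2 := fun z => by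
    simp [h]
  have h_one : ∀ z ∈ ball c R, h z ≠ 1 := fun z hz hone => h₂ ⟨z, hz, by
    simp only [h] at hone
    field_simp at hone
    linear_combination hone / 2⟩
  have h_neg_one : ∀ z ∈ ball c R, h z ≠ -1 := fun z hz hone => h₁ ⟨z, hz, by
    simpa [h, hw', sub_eq_zero] using hone⟩
  have hc : ‖h c‖ ≤ 1 + 2 * B := by
    have hgc := (div_le_iff₀ (norm_pos_iff.2 hw')).2 hB
    rw [hgh] at hgc
    have := norm_sub_le (h c + 1) 1
    rw [add_sub_cancel_right, norm_one] at this
    linarith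
  rw [← div_le_iff₀ (norm_pos_iff.2 hw'), hgh, schottkyBound]
  have hhz := norm_le_of_ne_one_of_ne_neg_one hθ₀ hθ
    ((((hg.sub_const w₁).div_const (w₂ - w₁)).const_mul 2).sub_const 1) h_one h_neg_one hz
  gcongr
  calc ‖h z + 1‖ ≤ 1 + ‖h z‖ := by simpa [add_comm] using norm_add_le (h z) 1
    _ ≤ 1 + Real.exp (π * Real.exp (π * (2 + ‖h c‖ + 144 * θ / (1 - θ)))) := by gcongr
    _ ≤ _ := by gcongr _ + Real.exp (π * Real.exp (π * (?_ + _))); linarith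

theorem dist_mul_exp_I_mul_le (z : ℂ) (t t' : ℝ) :
    dist (z * Complex.exp (Complex.I * t)) (z * Complex.exp (Complex.I * t')) ≤
      ‖z‖ * |t - t'| := by
  have hsub : z * Complex.exp (Complex.I * t) - z * Complex.exp (Complex.I * t') =
      z * Complex.exp (Complex.I * t') * (Complex.exp (Complex.I * (t - t' : ℝ)) - 1) := by
    rw [mul_sub, mul_assoc, ← Complex.exp_add, mul_one]
    push_cast
    ring_nf
  rw [dist_eq_norm, hsub, norm_mul, norm_mul, Complex.norm_exp_I_mul_ofReal, mul_one]
  gcongr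
  exact Real.norm_exp_I_mul_ofReal_sub_one_le

theorem exists_eq_mul_exp_I_mul {z₀ z : ℂ} (hz : ‖z₀‖ = ‖z‖) :
    ∃ t : ℝ, |t| ≤ π ∧ z = z₀ * Complex.exp (Complex.I * t) := by
  rcases eq_or_ne z₀ 0 with rfl | h₀
  · exact ⟨0, by simp [Real.pi_pos.le], by simpa using hz.symm⟩
  refine ⟨(z / z₀).arg, Complex.abs_arg_le_pi _, ?_⟩
  have h := Complex.norm_mul_exp_arg_mul_I (z / z₀)
  rw [norm_div, hz, div_self (by rw [← hz]; exact norm_ne_zero_iff.2 h₀), Complex.ofReal_one,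
    one_mul, mul_comm] at h
  rw [h]
  field_simp

theorem norm_sub_le_schottkyBound_iterate_mul {g : ℂ → ℂ} {w₁ w₂ z₀ z : ℂ} {s d B : ℝ} {N : ℕ}
    (hg : DifferentiableOn ℂ g (openAnnulus (s - d) (s + d))) (hw : w₁ ≠ w₂)
    (h₁ : w₁ ∉ g '' openAnnulus (s - d) (s + d)) (h₂ : w₂ ∉ g '' openAnnulus (s - d) (s + d))
    (hN : 2 * π * s < N * d) (hz₀ : ‖z₀‖ = s) (hz : ‖z‖ = s) (hB : ‖g z₀ - w₁‖ ≤ B * ‖w₂ - w₁‖) :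
    ‖g z - w₁‖ ≤ (schottkyBound (1 / 2))^[N] B * ‖w₂ - w₁‖ := by
  obtain ⟨t, ht, rfl⟩ := exists_eq_mul_exp_I_mul (hz₀.trans hz.symm)
  let γ : ℕ → ℂ := fun k => z₀ * Complex.exp (Complex.I * (k / N * t : ℝ))
  have hN₀ : 0 < (N : ℝ) := by
    have hs : 0 ≤ s := hz₀ ▸ norm_nonneg z₀
    by_contra! h
    have : (N : ℝ) = 0 := le_antisymm h N.cast_nonneg
    rw [this, zero_mul] at hN
    nlinarith [Real.pi_pos]
  have hball : ∀ k, ball (γ k) d ⊆ openAnnulus (s - d) (s + d) := fun k x hx => by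
    have hγ : ‖γ k‖ = s := by
      rw [norm_mul, Complex.norm_exp_I_mul_ofReal, mul_one, hz₀]
    have hx' := (abs_norm_sub_norm_le x (γ k)).trans_lt (mem_ball_iff_norm.1 hx)
    rw [hγ, abs_lt] at hx'
    exact ⟨by linarith, by linarith⟩
  have hstep : ∀ k, γ (k + 1) ∈ ball (γ k) (1 / 2 * d) := fun k => by
    refine (dist_mul_exp_I_mul_le _ _ _).trans_lt ?_
    have hk : ((k + 1 : ℕ) : ℝ) / N * t - k / N * t = t / N := by
      push_cast
      ring
    rw [hk, abs_div, abs_of_pos hN₀, hz₀, mul_div_assoc', div_lt_iff₀ hN₀]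
    nlinarith [hz₀ ▸ norm_nonneg z₀]
  have hiter : ∀ k, ‖g (γ k) - w₁‖ ≤ (schottkyBound (1 / 2))^[k] B * ‖w₂ - w₁‖ := by
    intro k
    induction k with
    | zero => simpa [γ] using hB
    | succ k ih =>
      rw [Function.iterate_succ_apply']
      exact norm_sub_le_schottkyBound_mul one_half_pos one_half_lt_one (hg.mono (hball k)) hw
        (notMem_subset (image_mono (hball k)) h₁) (notMem_subset (image_mono (hball k)) h₂) ih
        (hstep k)
  simpa only [γ, div_self hN₀.ne', one_mul] using hiter N

/-! ### Growth of the maximum modulus -/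

theorem maxModulus_nonneg (f : ℂ → ℂ) (r : ℝ) : 0 ≤ maxModulus f r :=
  Real.sSup_nonneg (forall_mem_image.2 fun _ _ => norm_nonneg _)

theorem norm_le_maxModulus {f : ℂ → ℂ} (hf : Continuous f) (z : ℂ) : ‖f z‖ ≤ maxModulus f ‖z‖ :=
  le_csSup ((isCompact_sphere 0 ‖z‖).image hf.norm).bddAbove ⟨z, by simp, rfl⟩

theorem maxModulus_le {f : ℂ → ℂ} {r b : ℝ} (hr : 0 ≤ r) (h : ∀ z, ‖z‖ = r → ‖f z‖ ≤ b) :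
    maxModulus f r ≤ b :=
  csSup_le ((NormedSpace.sphere_nonempty.2 hr).image _)
    (forall_mem_image.2 fun z hz => h z (mem_sphere_zero_iff_norm.1 hz))

theorem exists_norm_eq_minModulus {f : ℂ → ℂ} (hf : Continuous f) {r : ℝ} (hr : 0 ≤ r) :
    ∃ z, ‖z‖ = r ∧ ‖f z‖ = minModulus f r := by
  obtain ⟨z, hz, h⟩ := ((isCompact_sphere (0 : ℂ) r).image hf.norm).sInf_mem
    ((NormedSpace.sphere_nonempty.2 hr).image _)
  exact ⟨z, mem_sphere_zero_iff_norm.1 hz, h⟩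

theorem norm_le_maxModulus_of_norm_le {f : ℂ → ℂ} (hf : Differentiable ℂ f) {z : ℂ} {r : ℝ}
    (hz : ‖z‖ ≤ r) : ‖f z‖ ≤ maxModulus f r := by
  rcases hz.eq_or_lt with rfl | h
  · exact norm_le_maxModulus hf.continuous z
  · refine Complex.norm_le_of_forall_mem_frontier_norm_le (U := ball 0 r) isBounded_ball
      hf.diffContOnCl (fun x hx => ?_) (subset_closure (mem_ball_zero_iff.2 h))
    rw [← mem_sphere_zero_iff_norm.1 (frontier_ball_subset_sphere hx)]
    exact norm_le_maxModulus hf.continuous x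

theorem maxModulus_le_maxModulus {f : ℂ → ℂ} (hf : Differentiable ℂ f) {r s : ℝ} (hr : 0 ≤ r)
    (hrs : r ≤ s) : maxModulus f r ≤ maxModulus f s :=
  maxModulus_le hr fun _ hz => norm_le_maxModulus_of_norm_le hf (hz.trans_le hrs)

theorem maxModulus_sub_le {f g : ℂ → ℂ} (hf : Continuous f) (hg : Continuous g) {r : ℝ}
    (hr : 0 ≤ r) : maxModulus f r - maxModulus g r ≤ maxModulus (f - g) r := by
  rw [sub_le_iff_le_add]
  refine maxModulus_le hr fun z hz => ?_
  subst hz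
  calc ‖f z‖ ≤ ‖f z - g z‖ + ‖g z‖ := by simpa using norm_add_le (f z - g z) (g z)
    _ ≤ _ := add_le_add (norm_le_maxModulus (hf.sub hg) z) (norm_le_maxModulus hg z)

theorem maxModulus_sub_comm (f g : ℂ → ℂ) (r : ℝ) :
    maxModulus (f - g) r = maxModulus (g - f) r := by
  simp only [maxModulus, Pi.sub_apply, norm_sub_rev]

theorem abs_maxModulus_sub_le {f g : ℂ → ℂ} (hf : Continuous f) (hg : Continuous g) {r : ℝ}
    (hr : 0 ≤ r) : |maxModulus f r - maxModulus g r| ≤ maxModulus (f - g) r :=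
  abs_sub_le_iff.2
    ⟨maxModulus_sub_le hf hg hr, maxModulus_sub_comm f g r ▸ maxModulus_sub_le hg hf hr⟩

theorem maxModulus_pow_mul {q : ℂ → ℂ} (hq : Continuous q) (d : ℕ) {r : ℝ} (hr : 0 ≤ r) :
    maxModulus (fun z => z ^ d * q z) r = r ^ d * maxModulus q r := by
  have himage : (fun z => ‖z ^ d * q z‖) '' sphere (0 : ℂ) r =
      (fun x => r ^ d * x) '' ((fun z => ‖q z‖) '' sphere (0 : ℂ) r) := by
    rw [image_image]
    refine image_congr fun z hz => ?_
    rw [norm_mul, norm_pow, mem_sphere_zero_iff_norm.1 hz]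
  rw [maxModulus, himage]
  exact (Monotone.map_csSup_of_continuousAt (by fun_prop)
    (fun _ _ h => by gcongr) ((NormedSpace.sphere_nonempty.2 hr).image _)
    ((isCompact_sphere (0 : ℂ) r).image hq.norm).bddAbove).symm

theorem isLittleO_maxModulus {f : ℂ → ℂ} {g : ℝ → ℝ}
    (h : f =o[cobounded ℂ] fun z => g ‖z‖) : maxModulus f =o[atTop] g := by
  refine isLittleO_iff.2 fun ε hε => ?_
  have hle := isLittleO_iff.1 h hε
  rw [← comap_norm_atTop, eventually_comap] at hle
  filter_upwards [hle, eventually_ge_atTop 0] with r hr hr₀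
  rw [Real.norm_of_nonneg (maxModulus_nonneg f r)]
  exact maxModulus_le hr₀ fun z hz => hz ▸ hr z hz

theorem exists_eq_eval_add_pow_mul {f : ℂ → ℂ} (hf : Differentiable ℂ f) (d : ℕ) :
    ∃ (p : Polynomial ℂ) (q : ℂ → ℂ), p.degree < d ∧ Differentiable ℂ q ∧
      ∀ z, f z = p.eval z + z ^ d * q z := by
  induction d with
  | zero => exact ⟨0, f, by simp, hf, by simp⟩
  | succ d ih =>
    obtain ⟨p, q, hp, hq, h⟩ := ih
    have hq' : Differentiable ℂ (dslope q 0) :=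
      differentiableOn_univ.1 ((Complex.differentiableOn_dslope univ_mem).2 hq.differentiableOn)
    refine ⟨p + Polynomial.monomial d (q 0), dslope q 0, ?_, hq', fun z => ?_⟩
    · refine (Polynomial.degree_add_le _ _).trans_lt (max_lt ?_ ?_)
      · exact hp.trans (by exact_mod_cast d.lt_succ_self)
      · exact (Polynomial.degree_monomial_le _ _).trans_lt (by exact_mod_cast d.lt_succ_self)
    · have hz : z * dslope q 0 z = q z - q 0 := by simpa using sub_smul_dslope q 0 z
      rw [h, Polynomial.eval_add, Polynomial.eval_monomial]
      linear_combination -z ^ d * hz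

theorem isBigO_one_maxModulus {q : ℂ → ℂ} (hq : Differentiable ℂ q) (hq₀ : ∃ z, q z ≠ 0) :
    (fun _ => (1 : ℝ)) =O[atTop] maxModulus q := by
  obtain ⟨z₀, hz₀⟩ := hq₀
  refine IsBigO.of_bound ‖q z₀‖⁻¹ ?_
  filter_upwards [eventually_ge_atTop ‖z₀‖] with r hr
  rw [norm_one, Real.norm_of_nonneg (maxModulus_nonneg q r),
    le_inv_mul_iff₀ (norm_pos_iff.2 hz₀), mul_one]
  exact norm_le_maxModulus_of_norm_le hq hr

theorem isBigO_pow_pow_mul_maxModulus {q : ℂ → ℂ} (hq : Differentiable ℂ q) (hq₀ : ∃ z, q z ≠ 0)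
    (d : ℕ) : (fun r => r ^ d) =O[atTop] fun r => r ^ d * maxModulus q r := by
  simpa only [mul_one] using (isBigO_refl (fun r : ℝ => r ^ d) atTop).mul
    (isBigO_one_maxModulus hq hq₀)

theorem IsTranscendentalEntire.exists_isEquivalent_maxModulus {f : ℂ → ℂ}
    (hf : IsTranscendentalEntire f) (d : ℕ) :
    ∃ q : ℂ → ℂ, Differentiable ℂ q ∧ (∃ z, q z ≠ 0) ∧
      maxModulus f ~[atTop] fun r => r ^ d * maxModulus q r := by
  obtain ⟨p, q, hp, hq, h⟩ := exists_eq_eval_add_pow_mul hf.1 d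
  have hq₀ : ∃ z, q z ≠ 0 := by
    by_contra! hq₀
    exact hf.2 ⟨p, fun z => by rw [h, hq₀, mul_zero, add_zero]⟩
  have hsub : (f - fun z => z ^ d * q z) = p.eval := by
    ext z
    rw [Pi.sub_apply, h, add_sub_cancel_right]
  have hp_pow : maxModulus p.eval =o[atTop] fun r => r ^ d := by
    refine isLittleO_maxModulus (isLittleO_norm_right.1 ?_)
    have hdeg : p.degree < (Polynomial.X ^ d : Polynomial ℂ).degree := by
      rwa [Polynomial.degree_X_pow]
    simpa using (Polynomial.isLittleO_cobounded_of_degree_lt hdeg).norm_right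
  have hdiff : (maxModulus f - fun r => r ^ d * maxModulus q r) =O[atTop] maxModulus p.eval := by
    refine IsBigO.of_bound' ?_
    filter_upwards [eventually_ge_atTop 0] with r hr
    rw [← hsub, Pi.sub_apply, ← maxModulus_pow_mul hq.continuous d hr]
    exact (abs_maxModulus_sub_le hf.1.continuous
      ((continuous_pow d).mul hq.continuous) hr).trans (le_abs_self _)
  exact ⟨q, hq, hq₀,
    (hdiff.trans_isLittleO hp_pow).trans_isBigO (isBigO_pow_pow_mul_maxModulus hq hq₀ d)⟩

theorem IsTranscendentalEntire.isLittleO_pow_maxModulus {f : ℂ → ℂ}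
    (hf : IsTranscendentalEntire f) (d : ℕ) : (fun r => r ^ d) =o[atTop] maxModulus f := by
  obtain ⟨q, hq, hq₀, hfq⟩ := hf.exists_isEquivalent_maxModulus (d + 1)
  exact ((isLittleO_pow_pow_atTop_of_lt d.lt_succ_self).trans_isBigO
    (isBigO_pow_pow_mul_maxModulus hq hq₀ (d + 1))).trans_isEquivalent hfq.symm

theorem IsTranscendentalEntire.eventually_le_maxModulus {f : ℂ → ℂ}
    (hf : IsTranscendentalEntire f) : ∀ᶠ r in atTop, r ≤ maxModulus f r := by
  filter_upwards [(hf.isLittleO_pow_maxModulus 1).def one_pos] with r hr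
  rw [one_mul, pow_one, Real.norm_of_nonneg (maxModulus_nonneg f r)] at hr
  exact (le_abs_self r).trans hr

theorem IsTranscendentalEntire.eventually_mul_maxModulus_le {f : ℂ → ℂ}
    (hf : IsTranscendentalEntire f) {l : ℝ} (hl : 1 < l) (K : ℝ) :
    ∀ᶠ r in atTop, K * maxModulus f r ≤ maxModulus f (l * r) := by
  obtain ⟨d, hd⟩ := pow_unbounded_of_one_lt (3 * K) hl
  obtain ⟨q, hq, -, hfq⟩ := hf.exists_isEquivalent_maxModulus d
  have hl₀ : 0 < l := one_pos.trans hl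
  have hclose : ∀ᶠ r in atTop,
      |maxModulus f r - r ^ d * maxModulus q r| ≤ 1 / 2 * |r ^ d * maxModulus q r| :=
    hfq.isLittleO.def one_half_pos
  filter_upwards [hclose, (tendsto_id.const_mul_atTop hl₀).eventually hclose,
    eventually_ge_atTop 0] with r hr hlr hr₀
  simp only [id] at hlr
  have hnonneg : ∀ t, 0 ≤ t → 0 ≤ t ^ d * maxModulus q t := fun t ht =>
    mul_nonneg (pow_nonneg ht d) (maxModulus_nonneg q t)
  have hq_mono : maxModulus q r ≤ maxModulus q (l * r) :=
    maxModulus_le_maxModulus hq hr₀ (le_mul_of_one_le_left hr₀ hl.le)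
  rw [abs_of_nonneg (hnonneg r hr₀), abs_le] at hr
  rw [abs_of_nonneg (hnonneg (l * r) (by positivity)), abs_le] at hlr
  calc K * maxModulus f r ≤ l ^ d / 3 * maxModulus f r :=
        mul_le_mul_of_nonneg_right (by linarith) (maxModulus_nonneg f r)
    _ ≤ l ^ d / 3 * (3 / 2 * (r ^ d * maxModulus q r)) := by gcongr; linarith [hr.2]
    _ = (l * r) ^ d * maxModulus q r / 2 := by rw [mul_pow]; ring
    _ ≤ (l * r) ^ d * maxModulus q (l * r) / 2 := by gcongr
    _ ≤ maxModulus f (l * r) := by linarith [hlr.1]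

theorem maxModulus_le_of_forall_not_sphere_subset_image {f : ℂ → ℂ} (hf : Differentiable ℂ f)
    {t r R θ : ℝ} (ht : 0 < t) (hθ₀ : 0 < θ) (hθ : θ < 1) (h₀ : ‖f 0‖ ≤ t)
    (h : ∀ T, t ≤ T → ¬ sphere 0 T ⊆ f '' ball 0 R) (hr : 0 ≤ r) (hrR : r < θ * R) :
    maxModulus f r ≤ (1 + 3 * schottkyBound θ 2) * t := by
  obtain ⟨w₁, hw₁, hf₁⟩ := not_subset.1 (h t le_rfl)
  obtain ⟨w₂, hw₂, hf₂⟩ := not_subset.1 (h (2 * t) (by linarith))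
  rw [mem_sphere_zero_iff_norm] at hw₁ hw₂
  have hlow : t ≤ ‖w₂ - w₁‖ := by linarith [norm_sub_norm_le w₂ w₁]
  have hup : ‖w₂ - w₁‖ ≤ 3 * t := by linarith [norm_sub_le w₂ w₁]
  have hne : w₁ ≠ w₂ := by
    rintro rfl
    linarith
  refine maxModulus_le hr fun z hz => ?_
  have hfz := norm_sub_le_schottkyBound_mul hθ₀ hθ hf.differentiableOn hne hf₁ hf₂ (B := 2)
    (by linarith [norm_sub_le (f 0) w₁]) (mem_ball_zero_iff.2 (hz.trans_lt hrR))
  calc ‖f z‖ ≤ ‖w₁‖ + ‖f z - w₁‖ := norm_le_norm_add_norm_sub' _ _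
    _ ≤ t + schottkyBound θ 2 * (3 * t) := by
      rw [hw₁]
      gcongr
      exact hfz.trans (mul_le_mul_of_nonneg_left hup (schottkyBound_nonneg θ 2))
    _ = (1 + 3 * schottkyBound θ 2) * t := by ring

theorem IsTranscendentalEntire.eventually_exists_sphere_subset_image {f : ℂ → ℂ}
    (hf : IsTranscendentalEntire f) {l : ℝ} (hl : 1 < l) :
    ∀ᶠ r in atTop, ∃ T, l * maxModulus f r ≤ T ∧ sphere 0 T ⊆ f '' ball 0 (l * r) := by
  obtain ⟨a, ha, hal⟩ := exists_between hl
  obtain ⟨b, hab, hbl⟩ := exists_between hal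
  have hl₀ : 0 < l := by linarith
  have hb₀ : 0 < b := by linarith
  filter_upwards [eventually_gt_atTop 0, hf.eventually_le_maxModulus,
    hf.eventually_mul_maxModulus_le ha (l * (1 + 3 * schottkyBound (b / l) 2) + 1)]
    with r hr hMr hgrowth
  have hM : 0 < maxModulus f r := hr.trans_le hMr
  by_contra! h
  have h₀ : ‖f 0‖ ≤ l * maxModulus f r :=
    (norm_le_maxModulus_of_norm_le hf.1 (by simpa using hr.le)).trans
      (le_mul_of_one_le_left hM.le hl.le)
  have hle := maxModulus_le_of_forall_not_sphere_subset_image hf.1 (r := a * r) (θ := b / l)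
    (by positivity) (by positivity) ((div_lt_one hl₀).2 hbl) h₀ h (by positivity)
    (by rw [← mul_assoc, div_mul_cancel₀ _ hl₀.ne']; gcongr)
  linarith

theorem eventually_atTop_forall_iterate {α : Type*} [Preorder α] [IsDirectedOrder α] [Nonempty α]
    {g : α → α} {P : α → Prop} (hg : ∀ᶠ x in atTop, x ≤ g x) (hP : ∀ᶠ x in atTop, P x) :
    ∀ᶠ x in atTop, ∀ n, P (g^[n] x) := by
  obtain ⟨R, hR⟩ := eventually_atTop.1 (hg.and hP)
  have hmaps : MapsTo g (Ici R) (Ici R) := fun x hx => le_trans hx (hR x hx).1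
  filter_upwards [eventually_ge_atTop R] with x hx n
  exact (hR _ (hmaps.iterate n hx)).2

theorem maxModulus_le_comp {f h : ℂ → ℂ} (hf : Differentiable ℂ f) (hh : Differentiable ℂ h)
    {r t T : ℝ} (ht : 0 ≤ t) (htT : t ≤ T) (hT : sphere 0 T ⊆ f '' ball 0 r) :
    maxModulus h t ≤ maxModulus (h ∘ f) r := by
  refine (maxModulus_le_maxModulus hh ht htT).trans (maxModulus_le (ht.trans htT) fun w hw => ?_)
  obtain ⟨z, hz, rfl⟩ := hT (mem_sphere_zero_iff_norm.2 hw)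
  exact norm_le_maxModulus_of_norm_le (hh.comp hf) (mem_ball_zero_iff.1 hz).le

theorem IsTranscendentalEntire.eventually_maxModulus_le_comp_iterate {f : ℂ → ℂ}
    (hf : IsTranscendentalEntire f) {l : ℝ} (hl : 1 < l) :
    ∀ᶠ r in atTop, ∀ n, ∀ h : ℂ → ℂ, Differentiable ℂ h →
      maxModulus h (l * (maxModulus f)^[n] r) ≤ maxModulus (h ∘ f^[n]) (l * r) := by
  filter_upwards [eventually_atTop_forall_iterate hf.eventually_le_maxModulus
    (hf.eventually_exists_sphere_subset_image hl)] with r hsphere n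
  induction n with
  | zero => exact fun h _ => le_rfl
  | succ n ih =>
    intro h hh
    obtain ⟨T, hT, hT_sub⟩ := hsphere n
    rw [Function.iterate_succ_apply', Function.iterate_succ', ← Function.comp_assoc]
    exact (maxModulus_le_comp hf.1 hh
      (mul_nonneg (one_pos.trans hl).le (maxModulus_nonneg f _)) hT hT_sub).trans
      (ih (h ∘ f) (hh.comp hf.1))

theorem IsTranscendentalEntire.eventually_mul_iterate_maxModulus_le {f : ℂ → ℂ}
    (hf : IsTranscendentalEntire f) {l : ℝ} (hl : 1 < l) (K : ℝ) :
    ∀ᶠ r in atTop, ∀ n,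
      K * (maxModulus f)^[n + 1] r ≤ maxModulus f^[n + 1] (l * r) := by
  filter_upwards [hf.eventually_maxModulus_le_comp_iterate hl,
    eventually_atTop_forall_iterate hf.eventually_le_maxModulus
      (hf.eventually_mul_maxModulus_le hl K)] with r hcomp hgrowth n
  rw [Function.iterate_succ_apply', Function.iterate_succ' f]
  exact (hgrowth n).trans (hcomp n f hf.1)

/-! ### Covering -/

theorem maxModulus_le_of_notMem_image {g : ℂ → ℂ} (hg : Differentiable ℂ g) {w₁ w₂ : ℂ}
    {s d e η : ℝ} {N : ℕ} (hs : 0 ≤ s) (hN : 2 * π * s < N * d)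
    (h₁ : w₁ ∉ g '' openAnnulus (s - d) (s + d)) (h₂ : w₂ ∉ g '' openAnnulus (s - d) (s + d))
    (hη : minModulus g s ≤ η) (he : 0 < e) (hw : e * max ‖w₁‖ η ≤ ‖w₂ - w₁‖) :
    maxModulus g s ≤ ‖w₁‖ + (schottkyBound (1 / 2))^[N] (2 / e) * ‖w₂ - w₁‖ := by
  obtain ⟨z₀, hz₀, hmin⟩ := exists_norm_eq_minModulus hg.continuous hs
  have hd : 0 < d := pos_of_mul_pos_right (lt_of_le_of_lt (by positivity) hN) N.cast_nonneg
  have hne : w₁ ≠ w₂ := by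
    rintro rfl
    have hmax : max ‖w₁‖ η ≤ 0 := by
      rw [sub_self, norm_zero] at hw
      exact nonpos_of_mul_nonpos_right hw he
    have hw₁ : w₁ = 0 := norm_le_zero_iff.1 ((le_max_left _ _).trans hmax)
    have hgz₀ : g z₀ = 0 :=
      norm_le_zero_iff.1 (hmin.trans_le (hη.trans ((le_max_right _ _).trans hmax)))
    exact h₁ ⟨z₀, ⟨by linarith, by linarith⟩, hgz₀.trans hw₁.symm⟩
  have hB : ‖g z₀ - w₁‖ ≤ 2 / e * ‖w₂ - w₁‖ :=
    calc ‖g z₀ - w₁‖ ≤ ‖g z₀‖ + ‖w₁‖ := norm_sub_le _ _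
      _ ≤ max ‖w₁‖ η + max ‖w₁‖ η :=
        add_le_add (hmin.trans_le (hη.trans (le_max_right _ _))) (le_max_left _ _)
      _ = 2 / e * (e * max ‖w₁‖ η) := by field_simp; ring
      _ ≤ 2 / e * ‖w₂ - w₁‖ := by gcongr
  refine maxModulus_le hs fun z hz => (norm_le_norm_add_norm_sub' _ w₁).trans ?_
  gcongr
  exact norm_sub_le_schottkyBound_iterate_mul hg.differentiableOn hne h₁ h₂ hN hz₀ hz hB

theorem exists_ball_diff_ball_subset_image {l l' l'' e : ℝ} (hl : 1 < l) (hl' : l' < l'')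
    (he : 0 < e) :
    ∃ K : ℝ, ∀ (g : ℂ → ℂ) (r M η : ℝ), Differentiable ℂ g → 0 < r → 0 < M →
      K * M ≤ maxModulus g (l * r) → (∃ s ∈ Ioo (l * r) (l' * r), minModulus g s ≤ η) →
      ∃ w ∈ ball (0 : ℂ) M,
        ball (0 : ℂ) M \ ball w (e * max ‖w‖ η) ⊆ g '' openAnnulus r (l'' * r) := by
  let δ := min (l - 1) (l'' - l')
  have hδ : 0 < δ := lt_min (sub_pos.2 hl) (sub_pos.2 hl')
  obtain ⟨N, hN⟩ := exists_nat_gt (2 * π * l' / δ)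
  rw [div_lt_iff₀ hδ] at hN
  let Ψ := (schottkyBound (1 / 2))^[N] (2 / e)
  have hΨ : 0 ≤ Ψ := schottkyBound_iterate_nonneg _ (by positivity) N
  refine ⟨1 + 2 * Ψ, fun g r M η hg hr hM hK ⟨s, ⟨hls, hsl⟩, hη⟩ => ?_⟩
  by_contra! hcon
  obtain ⟨w₁, ⟨hw₁, -⟩, h₁⟩ := not_subset.1 (hcon 0 (mem_ball_self hM))
  obtain ⟨w₂, ⟨hw₂, hfar⟩, h₂⟩ := not_subset.1 (hcon w₁ hw₁)
  rw [mem_ball_iff_norm, not_lt] at hfar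
  rw [mem_ball_zero_iff] at hw₁ hw₂
  have hsub : openAnnulus (s - δ * r) (s + δ * r) ⊆ openAnnulus r (l'' * r) := by
    have hδl : δ * r ≤ (l - 1) * r := by gcongr; exact min_le_left _ _
    have hδl' : δ * r ≤ (l'' - l') * r := by gcongr; exact min_le_right _ _
    exact fun z hz => ⟨by linarith [hz.1], by linarith [hz.2]⟩
  have hNs : 2 * π * s < N * (δ * r) :=
    calc 2 * π * s ≤ 2 * π * (l' * r) := by gcongr
      _ = 2 * π * l' * r := by ring
      _ < N * δ * r := by gcongr
      _ = N * (δ * r) := by ring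
  have hlr : 0 ≤ l * r := by positivity
  have hmax := maxModulus_le_of_notMem_image hg (hlr.trans hls.le) hNs
    (notMem_subset (image_mono hsub) h₁) (notMem_subset (image_mono hsub) h₂) hη he hfar
  have hmono := maxModulus_le_maxModulus hg hlr hls.le
  have hdist : Ψ * ‖w₂ - w₁‖ ≤ Ψ * (2 * M) := by
    gcongr
    linarith [norm_sub_le w₂ w₁]
  linarith

theorem IsTranscendentalEntire.eventually_exists_ball_diff_ball_subset_image {f : ℂ → ℂ}
    (hf : IsTranscendentalEntire f) {l l' l'' e : ℝ} (hl : 1 < l) (hl' : l' < l'') (he : 0 < e) :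
    ∀ᶠ r in atTop, ∀ n, 1 ≤ n → ∀ η,
      (∃ s ∈ Ioo (l * r) (l' * r), minModulus f^[n] s ≤ η) →
      ∃ w ∈ ball (0 : ℂ) ((maxModulus f)^[n] r),
        ball (0 : ℂ) ((maxModulus f)^[n] r) \ ball w (e * max ‖w‖ η) ⊆
          f^[n] '' openAnnulus r (l'' * r) := by
  obtain ⟨K, hK⟩ := exists_ball_diff_ball_subset_image hl hl' he
  filter_upwards [eventually_gt_atTop 0, hf.eventually_mul_iterate_maxModulus_le hl K,
    eventually_atTop_forall_iterate hf.eventually_le_maxModulus (eventually_gt_atTop 0)]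
    with r hr hgrowth hpos n hn η
  obtain ⟨n, rfl⟩ := Nat.exists_eq_add_of_le' hn
  exact hK _ r _ η (hf.1.iterate _) hr (hpos _) (hgrowth n)

theorem exists_tendsto_atTop_eventually {α : Type*} {l : Filter α} {v : α → ℕ}
    (hv : Tendsto v l atTop) {P : ℕ → α → Prop} (hP : ∀ k, ∀ᶠ x in l, P k x) :
    ∃ κ : α → ℕ, Tendsto κ l atTop ∧ ∀ᶠ x in l, P (κ x) x := by
  classical
  refine ⟨fun x => Nat.findGreatest (P · x) (v x), tendsto_atTop.2 fun k => ?_, ?_⟩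
  · filter_upwards [hv.eventually_ge_atTop k, hP k] with x hvx hPx
    exact Nat.le_findGreatest hvx hPx
  · filter_upwards [hP 0] with x hPx
    exact Nat.findGreatest_spec (P := (P · x)) (v x).zero_le hPx

theorem theorem2p1 (f : ℂ → ℂ) (hf : IsTranscendentalEntire f)
    (lam lam' lam'' : ℝ) (h₁ : 1 < lam) (h₂ : lam < lam') (h₃ : lam' < lam'') :
    ∃ R' : ℝ, 0 < R' ∧ ∃ ε : ℝ → ℝ,
      Filter.Tendsto ε Filter.atTop (nhds 0) ∧
      ∀ r : ℝ, R' ≤ r → ∀ n : ℕ, 1 ≤ n → ∀ η : ℝ, 0 ≤ η →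
        (∃ s ∈ Set.Ioo (lam * r) (lam' * r), minModulus (f^[n]) s ≤ η) →
        ∃ w ∈ Metric.ball (0 : ℂ) ((maxModulus f)^[n] r),
          Metric.ball (0 : ℂ) ((maxModulus f)^[n] r) \ Metric.ball w (ε r * max ‖w‖ η) ⊆
            f^[n] '' openAnnulus r (lam'' * r) := by
  obtain ⟨κ, hκ, hcover⟩ := exists_tendsto_atTop_eventually (tendsto_nat_floor_atTop (α := ℝ))
    fun k => hf.eventually_exists_ball_diff_ball_subset_image h₁ h₃ (k.one_div_pos_of_nat (α := ℝ))
  obtain ⟨R', hR'⟩ := (hcover.and (eventually_gt_atTop 0)).exists_forall_of_atTop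
  exact ⟨R', (hR' R' le_rfl).2, fun r => 1 / (κ r + 1),
    tendsto_one_div_add_atTop_nhds_zero_nat.comp hκ, fun r hr n hn η _ => (hR' r hr).1 n hn η⟩
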